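/- Let $n\ge 1$ be an integer, let $p\in[1,\infty]$, and let $q$ be the conjugate exponent, $1/p+1/q=1$ (with $1/\infty=0$). Let $\mathcal P_n$ be the set of monic real polynomials of degree $n$. For $\varphi\in\mathcal P_n$ and $a<b$ put $\varphi_{a,b}(x)=\left(\frac{b-a}{2}\right)^n\varphi\!\left(\frac{2x-a-b}{b-a}\right)$, which is again in $\mathcal P_n$. For $f:[a,b]\to\mathbb R$ such that $f^{(n-1)}$ is absolutely continuous and $f^{(n)}\in L^p([a,b])$ let $$E_n(f)=\frac{(-1)^n}{n!}\int_a^b f^{(n)}(x)\,\varphi_{a,b}(x)\,dx .$$ Let $K_{n,p}(\varphi)$ be the smallest constant $K$ such that $$|E_n(f)|\le K\,\|f^{(n)}\|_{L^p([a,b])}\,(b-a)^{n+1/q}$$ for all $a<b$ and all such $f$, and let $\tilde K_{n,p}=\min_{\varphi\in\mathcal P_n}K_{n,p}(\varphi)$. Then the smallest constants and the minimum exist, and $\tilde K_{n,p}=K_{n,p}(\tilde\varphi)=2^{-n-1/q}\,\|\tilde\varphi\|_{L^q([-1,1])}/n!$ for some $\tilde\varphi\in\mathcal P_n$ at which the minimum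 is attained. Moreover $$\tilde K_{n,1}=\frac{2^{1-2n}}{n!},\qquad \tilde K_{n,2}=\frac{n!\,(2n+1)^{-1/2}}{(2n)!},\qquad \tilde K_{n,\infty}=\frac{2^{-2n}}{n!}.$$ For each fixed $n$, $\tilde K_{n,p}$ is a (strictly) decreasing function of $p\in[1,\infty]$, and so is $K_{n,p}(\varphi)$ for each fixed $\varphi\in\mathcal P_n$. Hence $\tilde K_{n,p}\le\tilde K_{n,1}$, and $K_{n,p}(\varphi)\le K_{n,1}(\varphi)$ for every $\varphi\in\mathcal P_n$. -/

import Mathlib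

open MeasureTheory Set Polynomial
open scoped ENNReal

noncomputable section

namespace Quadrature

/-- The real number `1/q`, where `q` is the conjugate exponent of `p ∈ [1, ∞]` (with `1/∞ = 0`). -/
def invConj (p : ℝ≥0∞) : ℝ := (ENNReal.conjExponent p)⁻¹.toReal

/-- The norm of `g` in `L^p([a,b])`, for Lebesgue measure (finite for `g ∈ L^p([a,b])`). -/
def lpNormOn (p : ℝ≥0∞) (a b : ℝ) (g : ℝ → ℝ) : ℝ :=
  (eLpNorm g p (volume.restrict (Icc a b))).toReal

/-- The `k`-th derivative of `f : [a,b] → ℝ` (one-sided at the end points). -/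
def derivOn (k : ℕ) (a b : ℝ) (f : ℝ → ℝ) : ℝ → ℝ :=
  iteratedDerivWithin k f (Icc a b)

/-- For `n ≥ 1`: `f^{(n-1)}` exists on `[a,b]` and is absolutely continuous there, and the
almost everywhere defined function `f^{(n)}` is in `L^p([a,b])`. -/
structure IsAdmissible (n : ℕ) (p : ℝ≥0∞) (a b : ℝ) (f : ℝ → ℝ) : Prop where
  contDiffOn : ContDiffOn ℝ ((n - 1 : ℕ) : ℕ∞) f (Icc a b)
  absolutelyContinuous : AbsolutelyContinuousOnInterval (derivOn (n - 1) a b f) a b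
  memLp : MemLp (derivOn n a b f) p (volume.restrict (Icc a b))

/-- The monic real polynomials of degree `n`. -/
def monicPolys (n : ℕ) : Set ℝ[X] := {φ | φ.Monic ∧ φ.natDegree = n}

/-- A monic polynomial of degree `n` on the reference interval `[-1,1]`, transplanted to `[a,b]`
by the increasing affine bijection and normalised so as to be monic again. -/
def transplant (n : ℕ) (φ : ℝ[X]) (a b : ℝ) (x : ℝ) : ℝ :=
  ((b - a) / 2) ^ n * φ.eval ((2 * x - a - b) / (b - a))

/-- The error term `E_n(f) = (-1)^n / n! ∫_a^b f^{(n)}(x) φ_n(x) dx`, where `φ_n` is the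
transplant of `φ` to `[a,b]`. -/
def errorTerm (n : ℕ) (φ : ℝ[X]) (a b : ℝ) (f : ℝ → ℝ) : ℝ :=
  (-1) ^ n / (n.factorial : ℝ) * ∫ x in a..b, derivOn n a b f x * transplant n φ a b x

/-- `C` is a constant, independent of `f` and of the interval, for which
`|E_n(f)| ≤ C ‖f^{(n)}‖_p (b-a)^{n+1/q}`. -/
def IsErrorConstant (n : ℕ) (p : ℝ≥0∞) (φ : ℝ[X]) (C : ℝ) : Prop :=
  ∀ a b : ℝ, a < b → ∀ f : ℝ → ℝ, IsAdmissible n p a b f →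
    |errorTerm n φ a b f| ≤
      C * lpNormOn p a b (derivOn n a b f) * (b - a) ^ ((n : ℝ) + invConj p)

/-- `K_{n,p}` for the polynomial `φ`: the smallest constant in the error estimate. -/
def errorConst (n : ℕ) (p : ℝ≥0∞) (φ : ℝ[X]) : ℝ :=
  sInf {C : ℝ | IsErrorConstant n p φ C}

/-- The optimal constant: the smallest value of `K_{n,p}` over the monic polynomials of
degree `n`. -/
def optimalConst (n : ℕ) (p : ℝ≥0∞) : ℝ :=
  sInf (errorConst n p '' monicPolys n)

end Quadrature

end

noncomputable section

namespace Quadrature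

/-! ### Norms of continuous functions on a compact interval -/

/-! Hölder bounds the error by the `L^q` norm of the transplanted polynomial, and the affine change
of variables turns this norm into a power of `b - a` times `‖φ‖_q` on `[-1,1]`
(`isErrorConstant_norm`). Nothing is lost: already on `[-1,1]` every continuous function is the
`n`-th derivative of an admissible function, and continuous functions suffice to compute `‖φ‖_q` by
duality. Hence `K_{n,p}(φ) = 2^{-n-1/q} ‖φ‖_q / n!` (`errorConst_eq`).

The optimal constant is therefore governed by the monic polynomial of least `L^q` norm on `[-1,1]`.
It exists by compactness in finite dimension; it is a multiple of Chebyshev's `T_n` for `q = ∞`, of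
`U_n` for `q = 1`, and the monic Legendre polynomial for `q = 2`.

For monotonicity, `2^{-1/q} ‖φ‖_q` is the power mean of `|φ|` for the uniform probability on
`[-1,1]`. It increases strictly with `q` because `|φ|` is not constant when `n ≥ 1`
(`normalized_lpNormOn_lt`), and `q` decreases as `p` increases. -/

lemma memLp_Icc_of_continuous {g : ℝ → ℝ} (hg : Continuous g) (p : ℝ≥0∞) (a b : ℝ) :
    MemLp g p (volume.restrict (Icc a b)) := by
  obtain ⟨M, hM⟩ := isCompact_Icc.exists_bound_of_continuousOn (s := Icc a b) hg.continuousOn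
  exact MemLp.of_bound hg.aestronglyMeasurable M
    ((ae_restrict_iff' measurableSet_Icc).2 (.of_forall hM))

lemma lpNormOn_nonneg (p : ℝ≥0∞) (a b : ℝ) (g : ℝ → ℝ) : 0 ≤ lpNormOn p a b g :=
  ENNReal.toReal_nonneg

lemma lpNormOn_congr {p : ℝ≥0∞} {a b : ℝ} {f g : ℝ → ℝ} (h : EqOn f g (Icc a b)) :
    lpNormOn p a b f = lpNormOn p a b g := by
  unfold lpNormOn
  rw [eLpNorm_congr_ae]
  exact (ae_restrict_iff' measurableSet_Icc).2 (.of_forall h)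

lemma lpNormOn_eq_rpow_integral {p : ℝ≥0∞} (hp0 : p ≠ 0) (hp : p ≠ ∞) {a b : ℝ} (hab : a ≤ b)
    {g : ℝ → ℝ} (hg : Continuous g) :
    lpNormOn p a b g = (∫ x in a..b, |g x| ^ p.toReal) ^ p.toReal⁻¹ := by
  unfold lpNormOn
  rw [(memLp_Icc_of_continuous hg p a b).eLpNorm_eq_integral_rpow_norm hp0 hp,
    ENNReal.toReal_ofReal (Real.rpow_nonneg (integral_nonneg fun _ => by positivity) _),
    intervalIntegral.integral_of_le hab, ← integral_Icc_eq_integral_Ioc]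
  simp [Real.norm_eq_abs]

lemma lpNormOn_top_le {a b : ℝ} {g : ℝ → ℝ} {M : ℝ} (hM0 : 0 ≤ M)
    (hM : ∀ x ∈ Icc a b, |g x| ≤ M) : lpNormOn ∞ a b g ≤ M := by
  unfold lpNormOn
  rw [eLpNorm_exponent_top]
  refine ENNReal.toReal_le_of_le_ofReal hM0 (eLpNormEssSup_le_of_ae_bound ?_)
  exact (ae_restrict_iff' measurableSet_Icc).2 (.of_forall hM)

lemma abs_le_lpNormOn_top {a b : ℝ} (hab : a < b) {g : ℝ → ℝ} (hg : Continuous g) {x : ℝ}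
    (hx : x ∈ Icc a b) : |g x| ≤ lpNormOn ∞ a b g := by
  set M := lpNormOn ∞ a b g with hM
  have hae : ∀ᵐ y ∂(volume.restrict (Icc a b)), |g y| ≤ M := by
    filter_upwards [enorm_ae_le_eLpNormEssSup g (volume.restrict (Icc a b))] with y hy
    have hfin := (memLp_Icc_of_continuous hg ∞ a b).eLpNorm_ne_top
    have := ENNReal.toReal_mono (by rwa [eLpNorm_exponent_top] at hfin) hy
    simpa [hM, lpNormOn, eLpNorm_exponent_top] using this
  -- The a.e. bound is recast as an a.e. equality of continuous functions, which then holds at every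
  -- point of the interval.
  have hmax : (fun y => max |g y| M) =ᵐ[volume.restrict (Icc a b)] fun _ => M := by
    filter_upwards [hae] with y hy using max_eq_right hy
  have := Measure.eqOn_Icc_of_ae_eq volume hab.ne hmax (by fun_prop) (by fun_prop) hx
  exact max_eq_right_iff.1 this

lemma lpNormOn_pos {p : ℝ≥0∞} (hp0 : p ≠ 0) {a b : ℝ} (hab : a < b) {g : ℝ → ℝ}
    (hg : Continuous g) {x : ℝ} (hx : x ∈ Icc a b) (hgx : g x ≠ 0) : 0 < lpNormOn p a b g := by
  refine ENNReal.toReal_pos (fun h => hgx ?_) (memLp_Icc_of_continuous hg p a b).eLpNorm_ne_top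
  rw [eLpNorm_eq_zero_iff hg.aestronglyMeasurable hp0] at h
  exact Measure.eqOn_Icc_of_ae_eq volume hab.ne h hg.continuousOn continuousOn_const hx

/-- Hölder's inequality on an interval. -/
lemma abs_integral_mul_le {p q : ℝ≥0∞} [p.HolderConjugate q] {a b : ℝ} (hab : a ≤ b)
    {f g : ℝ → ℝ} (hf : MemLp f p (volume.restrict (Icc a b)))
    (hg : MemLp g q (volume.restrict (Icc a b))) :
    |∫ x in a..b, f x * g x| ≤ lpNormOn p a b f * lpNormOn q a b g := by
  rw [intervalIntegral.integral_of_le hab, ← integral_Icc_eq_integral_Ioc]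
  have h1 := eLpNorm_smul_le_mul_eLpNorm (p := p) (q := q) (r := 1) hg.1 hf.1
  have h2 := ENNReal.toReal_mono (ENNReal.mul_ne_top hf.2.ne hg.2.ne) h1
  rw [ENNReal.toReal_mul] at h2
  refine le_trans ?_ h2
  have hi : Integrable (fun x => f x * g x) (volume.restrict (Icc a b)) :=
    hf.integrable_mul hg
  refine (abs_integral_le_integral_abs).trans (le_of_eq ?_)
  rw [eLpNorm_one_eq_lintegral_enorm]
  exact integral_norm_eq_lintegral_enorm hi.1

/-- When the conjugate exponent is `∞`, both sides are `0` because `0⁻¹ = 0`. -/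
lemma invConj_eq_inv_toReal (p : ℝ≥0∞) : invConj p = (ENNReal.conjExponent p).toReal⁻¹ := by
  simp [invConj, ENNReal.toReal_inv]

/-- The behaviour of norms under the affine bijection from `[a,b]` to `[-1,1]`. -/
lemma lpNormOn_comp_affine_le {q : ℝ≥0∞} (hq : 1 ≤ q) {a b : ℝ} (hab : a < b) {g : ℝ → ℝ}
    (hg : Continuous g) :
    lpNormOn q a b (fun x => g ((2 * x - a - b) / (b - a))) ≤
      ((b - a) / 2) ^ q.toReal⁻¹ * lpNormOn q (-1) 1 g := by
  have hba : 0 < b - a := sub_pos.2 hab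
  have hcont : Continuous fun x => g ((2 * x - a - b) / (b - a)) := by fun_prop
  rcases eq_or_ne q ∞ with rfl | hqt
  · simp only [ENNReal.toReal_top, inv_zero, Real.rpow_zero, one_mul]
    refine lpNormOn_top_le (lpNormOn_nonneg _ _ _ _) fun x hx => ?_
    refine abs_le_lpNormOn_top (by norm_num) hg ⟨?_, ?_⟩
    · rw [le_div_iff₀ hba]; linarith [hx.1]
    · rw [div_le_iff₀ hba]; linarith [hx.2]
  · have hq0 : q ≠ 0 := (zero_lt_one.trans_le hq).ne'
    rw [lpNormOn_eq_rpow_integral hq0 hqt hab.le hcont,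
      lpNormOn_eq_rpow_integral hq0 hqt (by norm_num) hg, ← Real.mul_rpow (by positivity)
        (intervalIntegral.integral_nonneg (by norm_num) fun _ _ => by positivity)]
    have h := intervalIntegral.integral_comp_mul_add (a := a) (b := b)
      (fun y => |g y| ^ q.toReal) (c := 2 / (b - a)) (by positivity) (-(a + b) / (b - a))
    have e1 : 2 / (b - a) * a + -(a + b) / (b - a) = -1 := by field_simp; ring
    have e2 : 2 / (b - a) * b + -(a + b) / (b - a) = 1 := by field_simp; ring
    rw [e1, e2, smul_eq_mul, inv_div] at h
    rw [← h]
    refine le_of_eq ?_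
    congr 2
    ext x
    congr 3
    field_simp
    ring

/-! ### The smallest constant for a fixed polynomial -/

lemma continuous_transplant (n : ℕ) (φ : ℝ[X]) (a b : ℝ) : Continuous (transplant n φ a b) := by
  unfold transplant
  have := φ.continuous
  fun_prop

lemma isErrorConstant_norm {n : ℕ} {p : ℝ≥0∞} (hp : 1 ≤ p) (φ : ℝ[X]) :
    IsErrorConstant n p φ ((2 : ℝ) ^ (-(n : ℝ) - invConj p) *
      lpNormOn (ENNReal.conjExponent p) (-1) 1 (fun x => φ.eval x) / (n.factorial : ℝ)) := by
  intro a b hab f hf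
  have hba : 0 < b - a := sub_pos.2 hab
  have hpq := ENNReal.HolderConjugate.conjExponent hp
  have hq : 1 ≤ ENNReal.conjExponent p := by simp [ENNReal.conjExponent]
  have hc := continuous_transplant n φ a b
  have h1 := abs_integral_mul_le hab.le hf.memLp
    (memLp_Icc_of_continuous hc (ENNReal.conjExponent p) a b)
  have h2 : lpNormOn (ENNReal.conjExponent p) a b (transplant n φ a b) =
      ((b - a) / 2) ^ n * lpNormOn (ENNReal.conjExponent p) a b
        (fun x => φ.eval ((2 * x - a - b) / (b - a))) := by
    unfold lpNormOn
    have : transplant n φ a b =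
        (((b - a) / 2) ^ n) • (fun x => φ.eval ((2 * x - a - b) / (b - a))) := by
      ext x; simp [transplant]
    rw [this, eLpNorm_const_smul, ENNReal.toReal_mul]
    congr 1
    rw [toReal_enorm, Real.norm_eq_abs, abs_of_pos (by positivity)]
  have h3 := lpNormOn_comp_affine_le hq hab φ.continuous
  rw [← invConj_eq_inv_toReal] at h3
  have h4 : lpNormOn (ENNReal.conjExponent p) a b (transplant n φ a b) ≤
      (2 : ℝ) ^ (-(n : ℝ) - invConj p) * (b - a) ^ ((n : ℝ) + invConj p) *
        lpNormOn (ENNReal.conjExponent p) (-1) 1 (fun x => φ.eval x) := by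
    rw [h2]
    refine (mul_le_mul_of_nonneg_left h3 (by positivity)).trans (le_of_eq ?_)
    rw [← mul_assoc]
    congr 1
    rw [← Real.rpow_natCast, ← Real.rpow_add (by positivity),
      Real.div_rpow hba.le (by norm_num), show -(n : ℝ) - invConj p = -(n + invConj p) by ring,
      Real.rpow_neg (by norm_num)]
    ring
  rw [errorTerm, abs_mul, abs_div, abs_pow, abs_neg, abs_one, one_pow, Nat.abs_cast]
  calc 1 / (n.factorial : ℝ) * |∫ x in a..b, derivOn n a b f x * transplant n φ a b x|
      ≤ 1 / (n.factorial : ℝ) * (lpNormOn p a b (derivOn n a b f) *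
        ((2 : ℝ) ^ (-(n : ℝ) - invConj p) * (b - a) ^ ((n : ℝ) + invConj p) *
        lpNormOn (ENNReal.conjExponent p) (-1) 1 (fun x => φ.eval x))) := by
        refine mul_le_mul_of_nonneg_left (h1.trans ?_) (by positivity)
        exact mul_le_mul_of_nonneg_left h4 (lpNormOn_nonneg _ _ _ _)
    _ = _ := by ring

/-! ### Sharpness: continuous test functions and duality -/

lemma exists_contDiff_iteratedDeriv_eq {g : ℝ → ℝ} (hg : Continuous g) (n : ℕ) :
    ∃ f : ℝ → ℝ, ContDiff ℝ n f ∧ iteratedDeriv n f = g := by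
  induction n with
  | zero => exact ⟨g, by simpa using hg, by simp⟩
  | succ n ih =>
    obtain ⟨f, hf, hfg⟩ := ih
    have hd : ∀ x, HasDerivAt (fun x => ∫ t in (0 : ℝ)..x, f t) (f x) x := fun x =>
      intervalIntegral.integral_hasDerivAt_right (hf.continuous.intervalIntegrable _ _)
        hf.continuous.aestronglyMeasurable.stronglyMeasurableAtFilter hf.continuous.continuousAt
    have hderiv : deriv (fun x => ∫ t in (0 : ℝ)..x, f t) = f := funext fun x => (hd x).deriv
    refine ⟨fun x => ∫ t in (0 : ℝ)..x, f t, ?_, ?_⟩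
    · push_cast
      rw [contDiff_succ_iff_deriv]
      exact ⟨fun x => (hd x).differentiableAt, by simp, by rwa [hderiv]⟩
    · rw [iteratedDeriv_succ', hderiv, hfg]

lemma exists_isAdmissible_derivOn_eq {g : ℝ → ℝ} (hg : Continuous g) {n : ℕ} (hn : 1 ≤ n)
    (p : ℝ≥0∞) {a b : ℝ} (hab : a < b) :
    ∃ f : ℝ → ℝ, IsAdmissible n p a b f ∧ EqOn (derivOn n a b f) g (Icc a b) := by
  obtain ⟨f, hf, hfg⟩ := exists_contDiff_iteratedDeriv_eq hg n
  have hu := uniqueDiffOn_Icc hab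
  have heq : EqOn (derivOn n a b f) g (Icc a b) := fun x hx => by
    rw [derivOn, iteratedDerivWithin_eq_iteratedDeriv hu hf.contDiffAt hx, hfg]
  have hle : ((n - 1 : ℕ) : WithTop ℕ∞) ≤ n := by exact_mod_cast Nat.sub_le n 1
  refine ⟨f, ⟨?_, ?_, ?_⟩, heq⟩
  · exact (hf.of_le hle).contDiffOn
  · refine ContDiffOn.absolutelyContinuousOnInterval ?_
    rw [uIcc_of_le hab.le]
    have h1 : ContDiff ℝ 1 (iteratedDeriv (n - 1) f) := by
      rw [iteratedDeriv_eq_iterate]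
      refine ContDiff.iterate_deriv' 1 (n - 1) (hf.of_le ?_)
      exact_mod_cast (by omega : 1 + (n - 1) ≤ n)
    exact h1.contDiffOn.congr fun x hx =>
      iteratedDerivWithin_eq_iteratedDeriv hu (hf.of_le hle).contDiffAt hx
  · refine (memLp_congr_ae ?_).2 (memLp_Icc_of_continuous hg p a b)
    exact (ae_restrict_iff' measurableSet_Icc).2 (.of_forall heq)

lemma transplant_neg_one_one (n : ℕ) (φ : ℝ[X]) (x : ℝ) : transplant n φ (-1) 1 x = φ.eval x := by
  unfold transplant
  norm_num

/-- Sharpness needs only the interval `[-1,1]`, where the transplant is `φ` itself and `b - a = 2`.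
-/
lemma IsErrorConstant.abs_integral_mul_le {n : ℕ} (hn : 1 ≤ n) {p : ℝ≥0∞} {φ : ℝ[X]} {C : ℝ}
    (hC : IsErrorConstant n p φ C) {g : ℝ → ℝ} (hg : Continuous g) :
    |∫ x in (-1)..1, g x * φ.eval x| ≤
      (C * (n.factorial : ℝ) * (2 : ℝ) ^ ((n : ℝ) + invConj p)) * lpNormOn p (-1) 1 g := by
  obtain ⟨f, hf, hfg⟩ := exists_isAdmissible_derivOn_eq hg hn p (a := -1) (b := 1) (by norm_num)
  have h := hC (-1) 1 (by norm_num) f hf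
  rw [lpNormOn_congr hfg, errorTerm, abs_mul, abs_div, abs_pow, abs_neg, abs_one, one_pow,
    Nat.abs_cast, show (1 : ℝ) - -1 = 2 by norm_num] at h
  have hint : ∫ x in (-1)..1, derivOn n (-1) 1 f x * transplant n φ (-1) 1 x =
      ∫ x in (-1)..1, g x * φ.eval x := by
    refine intervalIntegral.integral_congr fun x hx => ?_
    rw [uIcc_of_le (by norm_num)] at hx
    simp only [hfg hx, transplant_neg_one_one]
  rw [hint, one_div, inv_mul_le_iff₀ (by positivity)] at h
  linarith

/-- The function is a difference of powers of the positive and negative parts. It makes the extremal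
function in Hölder's inequality continuous. -/
lemma continuous_sign_mul_rpow {s : ℝ} (hs : 0 < s) :
    Continuous fun x : ℝ => SignType.sign x * |x| ^ s := by
  have : (fun x : ℝ => (SignType.sign x : ℝ) * |x| ^ s) =
      fun x => (max x 0) ^ s - (max (-x) 0) ^ s := by
    ext x
    rcases lt_trichotomy x 0 with h | rfl | h
    · simp [h, abs_of_neg h, max_eq_right h.le, max_eq_left (neg_nonneg.2 h.le),
        Real.zero_rpow hs.ne']
    · simp
    · simp [h, abs_of_pos h, max_eq_left h.le, max_eq_right (neg_nonpos.2 h.le),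
        Real.zero_rpow hs.ne']
  rw [this]
  exact ((continuous_id.max continuous_const).rpow_const fun _ => .inr hs.le).sub
    ((continuous_neg.max continuous_const).rpow_const fun _ => .inr hs.le)

/-- Duality for `L¹` and continuous test functions. -/
lemma lpNormOn_one_le_of_forall_abs_integral_mul_le {a b : ℝ} (hab : a < b) {h : ℝ → ℝ}
    (hh : Continuous h) {D : ℝ}
    (hD : ∀ g : ℝ → ℝ, Continuous g → |∫ x in a..b, g x * h x| ≤ D * lpNormOn ∞ a b g) :
    lpNormOn 1 a b h ≤ D := by
  have hD0 : 0 ≤ D := by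
    have h1 := hD (fun _ => 1) continuous_const
    have h2 : 0 < lpNormOn ∞ a b (fun _ => 1) :=
      lpNormOn_pos (by simp) hab continuous_const (left_mem_Icc.2 hab.le) one_ne_zero
    exact nonneg_of_mul_nonneg_left ((abs_nonneg _).trans h1) h2
  rw [lpNormOn_eq_rpow_integral one_ne_zero ENNReal.one_ne_top hab.le hh]
  simp only [ENNReal.toReal_one, Real.rpow_one, inv_one]
  refine le_of_forall_pos_le_add fun ε hε => ?_
  -- `h / (|h| + δ)` is a continuous substitute for the sign of `h`; it loses at most `δ` pointwise,
  -- hence `ε` in total.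
  set δ := ε / (b - a) with hδ
  have hba : 0 < b - a := sub_pos.2 hab
  have hδ0 : 0 < δ := by positivity
  have hpos : ∀ x, 0 < |h x| + δ := fun x => by positivity
  have hgc : Continuous fun x => h x / (|h x| + δ) :=
    hh.div (by fun_prop) fun x => (hpos x).ne'
  have h1 := hD _ hgc
  have h2 : lpNormOn ∞ a b (fun x => h x / (|h x| + δ)) ≤ 1 := by
    refine lpNormOn_top_le zero_le_one fun x _ => ?_
    rw [abs_div, abs_of_pos (hpos x), div_le_one (hpos x)]
    linarith
  have h3 : ∫ x in a..b, (|h x| - δ) ≤ ∫ x in a..b, h x / (|h x| + δ) * h x := by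
    refine intervalIntegral.integral_mono_on hab.le
      (Continuous.intervalIntegrable (by fun_prop) _ _) ((hgc.mul hh).intervalIntegrable _ _)
      fun x _ => ?_
    rw [div_mul_eq_mul_div, le_div_iff₀ (hpos x), ← abs_mul_abs_self (h x)]
    nlinarith [sq_nonneg δ]
  rw [intervalIntegral.integral_sub (Continuous.intervalIntegrable (by fun_prop) _ _)
    (by simp), intervalIntegral.integral_const, smul_eq_mul, hδ,
    mul_div_cancel₀ _ hba.ne'] at h3
  have h4 : D * lpNormOn ∞ a b (fun x => h x / (|h x| + δ)) ≤ D := mul_le_of_le_one_right hD0 h2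
  linarith [le_abs_self (∫ x in a..b, h x / (|h x| + δ) * h x)]

/-- Duality for `L^∞` and continuous test functions. -/
lemma lpNormOn_top_le_of_forall_abs_integral_mul_le {a b : ℝ} (hab : a < b) {h : ℝ → ℝ}
    (hh : Continuous h) {D : ℝ}
    (hD : ∀ g : ℝ → ℝ, Continuous g → |∫ x in a..b, g x * h x| ≤ D * lpNormOn 1 a b g) :
    lpNormOn ∞ a b h ≤ D := by
  have hD0 : 0 ≤ D := by
    have h1 := hD (fun _ => 1) continuous_const
    have h2 : 0 < lpNormOn 1 a b (fun _ => 1) :=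
      lpNormOn_pos (by simp) hab continuous_const (left_mem_Icc.2 hab.le) one_ne_zero
    exact nonneg_of_mul_nonneg_left ((abs_nonneg _).trans h1) h2
  refine lpNormOn_top_le hD0 fun y hy => ?_
  by_contra! hlt
  obtain ⟨c, hDc, hcy⟩ := exists_between hlt
  have hc0 : 0 < c := hD0.trans_lt hDc
  -- `w` lives where `|h| > c`, so `w h ≥ c |w|`; as `w` has positive `L¹` norm, this contradicts `D
  -- < c`.
  set w : ℝ → ℝ := fun x => max 0 (|h x| - c) * h x with hw
  have hwc : Continuous w := by fun_prop
  have hwy : w y ≠ 0 := by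
    have : 0 < |h y| - c := by linarith
    refine mul_ne_zero (by rw [max_eq_right this.le]; exact this.ne') ?_
    exact abs_pos.1 (hc0.trans hcy)
  have h1 := hD w hwc
  have hpos := lpNormOn_pos one_ne_zero hab hwc hy hwy
  have h2 : c * lpNormOn 1 a b w ≤ ∫ x in a..b, w x * h x := by
    rw [lpNormOn_eq_rpow_integral one_ne_zero ENNReal.one_ne_top hab.le hwc]
    simp only [ENNReal.toReal_one, Real.rpow_one, inv_one]
    rw [← intervalIntegral.integral_const_mul]
    refine intervalIntegral.integral_mono_on hab.le
      (Continuous.intervalIntegrable (by fun_prop) _ _) ((hwc.mul hh).intervalIntegrable _ _)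
      fun x _ => ?_
    simp only [hw, abs_mul, abs_of_nonneg (le_max_left 0 (|h x| - c))]
    rw [mul_assoc _ (h x), ← abs_mul_abs_self (h x)]
    rcases le_total (|h x|) c with hx | hx
    · simp [max_eq_left (sub_nonpos.2 hx)]
    · have := mul_nonneg (le_max_left 0 (|h x| - c)) (abs_nonneg (h x))
      nlinarith
  nlinarith [le_abs_self (∫ x in a..b, w x * h x)]

/-- Duality for `L^p` with `1 < p < ∞` and continuous test functions. -/
lemma lpNormOn_le_of_forall_abs_integral_mul_le_of_ne_top {p q : ℝ≥0∞} [hpq : p.HolderConjugate q]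
    (hp : p ≠ ∞) (hq : q ≠ ∞) {a b : ℝ} (hab : a < b) {h : ℝ → ℝ} (hh : Continuous h) {D : ℝ}
    {y : ℝ} (hy : y ∈ Icc a b) (hhy : h y ≠ 0)
    (hD : ∀ g : ℝ → ℝ, Continuous g → |∫ x in a..b, g x * h x| ≤ D * lpNormOn p a b g) :
    lpNormOn q a b h ≤ D := by
  have hp0 : p ≠ 0 := ENNReal.HolderConjugate.ne_zero p q
  have hq0 : q ≠ 0 := (ENNReal.HolderConjugate.ne_zero q p)
  have hr : p.toReal.HolderConjugate q.toReal := ENNReal.HolderConjugate.toReal_of_ne_top hp hq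
  have hs : 0 < q.toReal - 1 := hr.symm.sub_one_pos
  -- The equality case of Hölder: both `g h` and `|g|^p` equal `|h|^q`.
  set g : ℝ → ℝ := fun x => SignType.sign (h x) * |h x| ^ (q.toReal - 1) with hg
  have hgc : Continuous g := (continuous_sign_mul_rpow hs).comp hh
  have h1 := hD g hgc
  have e1 : ∀ x, g x * h x = |h x| ^ q.toReal := fun x => by
    rw [hg]
    simp only
    rcases eq_or_ne (h x) 0 with h0 | h0
    · simp [h0, Real.zero_rpow hr.symm.ne_zero]
    · rw [mul_right_comm, sign_mul_self, ← Real.rpow_one_add' (abs_nonneg _) (by simp [hr.symm.ne_zero])]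
      congr 1; ring
  have e2 : ∀ x, |g x| ^ p.toReal = |h x| ^ q.toReal := fun x => by
    rw [hg]
    simp only
    rcases eq_or_ne (h x) 0 with h0 | h0
    · simp [h0, Real.zero_rpow hr.symm.ne_zero, Real.zero_rpow hr.ne_zero]
    · rw [abs_mul, abs_of_nonneg (Real.rpow_nonneg (abs_nonneg (h x)) _)]
      have : |((SignType.sign (h x) : SignType) : ℝ)| = 1 := by
        rcases h0.lt_or_gt with h | h <;> simp [h]
      rw [this, one_mul, ← Real.rpow_mul (abs_nonneg _), hr.symm.sub_one_mul_conj]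
  have hgy : g y ≠ 0 := by
    intro h0
    have := e1 y
    rw [h0, zero_mul] at this
    exact (Real.rpow_pos_of_pos (abs_pos.2 hhy) _).ne this
  rw [lpNormOn_eq_rpow_integral hp0 hp hab.le hgc] at h1
  simp only [e1, e2] at h1
  rw [lpNormOn_eq_rpow_integral hq0 hq hab.le hh]
  -- Positivity allows the factor `I^{1/p}` to be cancelled at the end.
  have hI : 0 < ∫ x in a..b, |h x| ^ q.toReal := by
    have := lpNormOn_pos hq0 hab hh hy hhy
    rw [lpNormOn_eq_rpow_integral hq0 hq hab.le hh] at this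
    refine lt_of_le_of_ne (intervalIntegral.integral_nonneg hab.le fun _ _ => by positivity)
      fun h0 => ?_
    rw [← h0, Real.zero_rpow (inv_ne_zero hr.symm.ne_zero)] at this
    exact this.false
  rw [abs_of_pos hI] at h1
  set I := ∫ x in a..b, |h x| ^ q.toReal
  have hsplit : I = I ^ q.toReal⁻¹ * I ^ p.toReal⁻¹ := by
    rw [← Real.rpow_add hI, add_comm, hr.inv_add_inv_eq_one, Real.rpow_one]
  have : I ^ q.toReal⁻¹ * I ^ p.toReal⁻¹ ≤ D * I ^ p.toReal⁻¹ := hsplit ▸ h1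
  exact le_of_mul_le_mul_right this (Real.rpow_pos_of_pos hI _)

lemma exists_mem_Icc_eval_ne_zero {φ : ℝ[X]} (hφ : φ ≠ 0) {a b : ℝ} (hab : a < b) :
    ∃ y ∈ Icc a b, φ.eval y ≠ 0 := by
  by_contra! h
  exact hφ (eq_zero_of_infinite_isRoot φ ((Icc_infinite hab).mono h))

lemma conjExponent_one : ENNReal.conjExponent 1 = ∞ := by simp [ENNReal.conjExponent]

lemma conjExponent_top : ENNReal.conjExponent ∞ = 1 := by simp [ENNReal.conjExponent]

lemma conjExponent_ne_top {p : ℝ≥0∞} (hp : 1 < p) : ENNReal.conjExponent p ≠ ∞ := by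
  simp [ENNReal.conjExponent, tsub_eq_zero_iff_le, hp]

lemma IsErrorConstant.lpNormOn_le {n : ℕ} (hn : 1 ≤ n) {p : ℝ≥0∞} (hp : 1 ≤ p) {φ : ℝ[X]}
    (hφ : φ ≠ 0) {C : ℝ} (hC : IsErrorConstant n p φ C) :
    lpNormOn (ENNReal.conjExponent p) (-1) 1 (fun x => φ.eval x) ≤
      C * (n.factorial : ℝ) * (2 : ℝ) ^ ((n : ℝ) + invConj p) := by
  have h11 : (-1 : ℝ) < 1 := by norm_num
  rcases hp.eq_or_lt with rfl | hp1
  · rw [conjExponent_one]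
    exact lpNormOn_top_le_of_forall_abs_integral_mul_le h11 φ.continuous
      fun g hg => hC.abs_integral_mul_le hn hg
  rcases eq_or_ne p ∞ with rfl | hpt
  · have := lpNormOn_one_le_of_forall_abs_integral_mul_le h11 φ.continuous
      fun g hg => hC.abs_integral_mul_le hn hg
    rwa [← conjExponent_top] at this
  · have hpq := ENNReal.HolderConjugate.conjExponent hp
    obtain ⟨y, hy, hφy⟩ := exists_mem_Icc_eval_ne_zero hφ h11
    exact lpNormOn_le_of_forall_abs_integral_mul_le_of_ne_top (p := p) hpt
      (conjExponent_ne_top hp1) h11 φ.continuous hy hφy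
      fun g hg => hC.abs_integral_mul_le hn hg

lemma isLeast_norm {n : ℕ} (hn : 1 ≤ n) {p : ℝ≥0∞} (hp : 1 ≤ p) {φ : ℝ[X]} (hφ : φ ≠ 0) :
    IsLeast {C : ℝ | IsErrorConstant n p φ C} ((2 : ℝ) ^ (-(n : ℝ) - invConj p) *
      lpNormOn (ENNReal.conjExponent p) (-1) 1 (fun x => φ.eval x) / (n.factorial : ℝ)) := by
  refine ⟨isErrorConstant_norm hp φ, fun C hC => ?_⟩
  have h := IsErrorConstant.lpNormOn_le hn hp hφ hC
  rw [div_le_iff₀ (by positivity), show -(n : ℝ) - invConj p = -(n + invConj p) by ring,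
    Real.rpow_neg (by norm_num), inv_mul_le_iff₀ (by positivity)]
  linarith

lemma errorConst_eq {n : ℕ} (hn : 1 ≤ n) {p : ℝ≥0∞} (hp : 1 ≤ p) {φ : ℝ[X]} (hφ : φ ≠ 0) :
    errorConst n p φ = (2 : ℝ) ^ (-(n : ℝ) - invConj p) *
      lpNormOn (ENNReal.conjExponent p) (-1) 1 (fun x => φ.eval x) / (n.factorial : ℝ) :=
  (isLeast_norm hn hp hφ).csInf_eq

/-! ### Monic polynomials of least norm for the exponents `∞`, `1` and `2` -/

lemma C_inv_mul_mem_monicPolys {n : ℕ} {P : ℝ[X]} (hP : P ≠ 0) (hn : P.natDegree = n) :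
    C P.leadingCoeff⁻¹ * P ∈ monicPolys n := by
  have h0 := leadingCoeff_ne_zero.2 hP
  exact ⟨monic_C_mul_of_mul_leadingCoeff_eq_one (inv_mul_cancel₀ h0),
    by rw [natDegree_C_mul (inv_ne_zero h0), hn]⟩

lemma integral_derivative (P : ℝ[X]) (a b : ℝ) :
    ∫ x in a..b, (derivative P).eval x = P.eval b - P.eval a :=
  intervalIntegral.integral_eq_sub_of_hasDerivAt (fun x _ => P.hasDerivAt x)
    ((derivative P).continuous.intervalIntegrable _ _)

/-- Divided by its sup norm `M`, `ψ` is bounded by 1 on `[-1,1]`, so its leading coefficient `M⁻¹`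
is at most that of `T_n`. -/
lemma lpNormOn_top_ge_of_mem_monicPolys {n : ℕ} {ψ : ℝ[X]} (hψ : ψ ∈ monicPolys n) :
    ((2 : ℝ) ^ (n - 1))⁻¹ ≤ lpNormOn ∞ (-1) 1 (fun x => ψ.eval x) := by
  have h11 : (-1 : ℝ) < 1 := by norm_num
  obtain ⟨y, hy, hψy⟩ := exists_mem_Icc_eval_ne_zero hψ.1.ne_zero h11
  have hM := lpNormOn_pos (p := ∞) (by simp) h11 ψ.continuous hy hψy
  set M := lpNormOn ∞ (-1) 1 (fun x => ψ.eval x) with hMdef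
  have h := Chebyshev.coeff_le_of_forall_abs_le_one (n := n) (P := C M⁻¹ * ψ) ?_ ?_
  · have hc : (C M⁻¹ * ψ).coeff n = M⁻¹ := by
      rw [coeff_C_mul, ← hψ.2, hψ.1.coeff_natDegree, mul_one]
    rw [hc] at h
    exact inv_le_of_inv_le₀ hM h
  · rw [degree_C_mul (inv_ne_zero hM.ne')]
    exact natDegree_le_iff_degree_le.1 hψ.2.le
  · intro x hx
    rw [eval_mul, eval_C, abs_mul, abs_of_pos (inv_pos.2 hM), inv_mul_le_one₀ hM]
    exact abs_le_lpNormOn_top h11 ψ.continuous hx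

lemma exists_mem_monicPolys_lpNormOn_top_le (n : ℕ) :
    ∃ φ ∈ monicPolys n, lpNormOn ∞ (-1) 1 (fun x => φ.eval x) ≤ ((2 : ℝ) ^ (n - 1))⁻¹ := by
  have hlc : (Chebyshev.T ℝ n).leadingCoeff = 2 ^ (n - 1) := by simp
  refine ⟨_, C_inv_mul_mem_monicPolys (n := n) (P := Chebyshev.T ℝ n) ?_ (by simp), ?_⟩
  · rw [← leadingCoeff_ne_zero, hlc]; positivity
  · refine lpNormOn_top_le (by positivity) fun x hx => ?_
    rw [hlc, eval_mul, eval_C, abs_mul, abs_of_pos (by positivity)]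
    exact mul_le_of_le_one_right (by positivity)
      (Chebyshev.abs_eval_T_real_le_one n (abs_le.2 hx))

/-! ### The exponent 1: a norming functional for `U_n` -/

/-- The integral over `[-1,1]` against the step function whose sign alternates at the extremal
points `cos (j π / N)` of the Chebyshev polynomial `T_N`. -/
def alternatingIntegral (N : ℕ) : ℝ[X] →ₗ[ℝ] ℝ where
  toFun P := ∑ j ∈ Finset.range N,
    (-1) ^ j * ∫ x in Chebyshev.node N (j + 1)..Chebyshev.node N j, P.eval x
  map_add' P Q := by
    rw [← Finset.sum_add_distrib]
    refine Finset.sum_congr rfl fun j _ => ?_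
    simp only [eval_add]
    rw [intervalIntegral.integral_add (P.continuous.intervalIntegrable _ _)
      (Q.continuous.intervalIntegrable _ _), mul_add]
  map_smul' c P := by
    rw [RingHom.id_apply, smul_eq_mul, Finset.mul_sum]
    refine Finset.sum_congr rfl fun j _ => ?_
    simp only [eval_smul, smul_eq_mul, intervalIntegral.integral_const_mul]
    ring

lemma alternatingIntegral_apply (N : ℕ) (P : ℝ[X]) :
    alternatingIntegral N P = ∑ j ∈ Finset.range N,
      (-1) ^ j * ∫ x in Chebyshev.node N (j + 1)..Chebyshev.node N j, P.eval x := rfl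

lemma integral_abs_eq_sum_nodes {N : ℕ} (hN : N ≠ 0) (P : ℝ[X]) :
    ∫ x in (-1)..1, |P.eval x| = ∑ j ∈ Finset.range N,
      ∫ x in Chebyshev.node N (j + 1)..Chebyshev.node N j, |P.eval x| := by
  have hc : Continuous fun x => |P.eval x| := P.continuous.abs
  have h := intervalIntegral.sum_integral_adjacent_intervals (μ := volume)
    (f := fun x => |P.eval x|) (a := Chebyshev.node N) (n := N)
    fun k _ => hc.intervalIntegrable _ _
  rw [Chebyshev.node_eq_one, Chebyshev.node_eq_neg_one hN] at h
  -- The nodes run down from `1` to `-1`, so every orientation has to be reversed.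
  rw [intervalIntegral.integral_symm, ← h, ← Finset.sum_neg_distrib]
  exact Finset.sum_congr rfl fun j _ => (intervalIntegral.integral_symm _ _).symm

lemma node_succ_le {N j : ℕ} (hj : j < N) : Chebyshev.node N (j + 1) ≤ Chebyshev.node N j :=
  (Chebyshev.node_lt hj (Nat.lt_succ_self j)).le

lemma alternatingIntegral_le {N : ℕ} (hN : N ≠ 0) (P : ℝ[X]) :
    alternatingIntegral N P ≤ ∫ x in (-1)..1, |P.eval x| := by
  rw [integral_abs_eq_sum_nodes hN, alternatingIntegral_apply]
  refine Finset.sum_le_sum fun j hj => (le_abs_self _).trans ?_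
  rw [abs_mul, abs_pow, abs_neg, abs_one, one_pow, one_mul]
  exact intervalIntegral.abs_integral_le_integral_abs (node_succ_le (Finset.mem_range.1 hj))

lemma integral_U (k : ℕ) (a b : ℝ) :
    ∫ x in a..b, (Chebyshev.U ℝ k).eval x =
      ((Chebyshev.T ℝ (k + 1 : ℕ)).eval b - (Chebyshev.T ℝ (k + 1 : ℕ)).eval a) / (k + 1) := by
  have h := integral_derivative (Chebyshev.T ℝ (k + 1 : ℕ)) a b
  rw [Chebyshev.T_derivative_eq_U] at h
  have e : ((k + 1 : ℕ) : ℤ) - 1 = k := by push_cast; ring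
  rw [e] at h
  simp only [eval_mul, Int.cast_natCast, eval_natCast] at h
  rw [intervalIntegral.integral_const_mul] at h
  rw [← h]
  push_cast
  field_simp

/-- `T_{n+1} / (n+1)` is a primitive of `U_n` and `T_{n+1}` is `(-1)^j` at the `j`-th node, so each
of the `n + 1` signed pieces equals `2 / (n+1)`. -/
lemma alternatingIntegral_U_self (n : ℕ) :
    alternatingIntegral (n + 1) (Chebyshev.U ℝ n) = 2 := by
  rw [alternatingIntegral_apply]
  have : ∀ j ∈ Finset.range (n + 1), (-1 : ℝ) ^ j *
      ∫ x in Chebyshev.node (n + 1) (j + 1)..Chebyshev.node (n + 1) j,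
        (Chebyshev.U ℝ n).eval x = 2 / (n + 1) := fun j hj => by
    have hj := Finset.mem_range.1 hj
    rw [integral_U, Chebyshev.eval_T_real_node (Finset.mem_Iic.2 hj.le),
      Chebyshev.eval_T_real_node (Finset.mem_Iic.2 hj)]
    have h1 : (-1 : ℝ) ^ j * (-1) ^ j = 1 := by rw [← mul_pow]; norm_num
    rw [← mul_div_assoc]
    congr 1
    rw [pow_succ]
    linear_combination 2 * h1
  rw [Finset.sum_congr rfl this, Finset.sum_const, Finset.card_range, nsmul_eq_mul]
  push_cast
  field_simp

/-- Summation of an alternating sum of differences of cosines. -/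
lemma sum_alternating_cos_sub_cos {α : ℝ} {N : ℕ} (hα : Real.cos (α / 2) ≠ 0)
    (hN : Real.sin (α * N) = 0) :
    ∑ j ∈ Finset.range N, (-1) ^ j * (Real.cos (α * j) - Real.cos (α * (j + 1))) = 0 := by
  -- Multiplication by `cos (α / 2)` makes the sum telescope, with boundary terms multiples of `sin
  -- 0` and `sin (α N)`.
  refine (mul_eq_zero.1 (?_ : Real.cos (α / 2) * _ = 0)).resolve_left hα
  rw [Finset.mul_sum]
  have h : ∀ j ∈ Finset.range N,
      Real.cos (α / 2) * ((-1) ^ j * (Real.cos (α * j) - Real.cos (α * (j + 1)))) =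
        (-Real.sin (α / 2) * (-1) ^ (j + 1) * Real.sin (α * (j + 1 : ℕ))) -
          (-Real.sin (α / 2) * (-1) ^ j * Real.sin (α * (j : ℕ))) := fun j _ => by
    obtain ⟨β, hβ⟩ : ∃ β, β = α * j + α / 2 := ⟨_, rfl⟩
    have e1 : α * j = β - α / 2 := by rw [hβ]; ring
    have e2 : α * ((j : ℝ) + 1) = β + α / 2 := by rw [hβ]; ring
    push_cast
    rw [e2, e1, Real.cos_sub, Real.cos_add, Real.sin_sub, Real.sin_add, pow_succ]
    ring
  rw [Finset.sum_congr rfl h]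
  rw [Finset.sum_range_sub (fun j : ℕ => -Real.sin (α / 2) * (-1) ^ j * Real.sin (α * (j : ℕ)))]
  simp [hN]

/-- At the nodes `T_{k+1}` takes the values `cos (α j)` with `α = (k+1)π/(n+1)`; `k < n` gives `α <
π`, so the alternating cosine sum vanishes. -/
lemma alternatingIntegral_U_of_lt {k n : ℕ} (hk : k < n) :
    alternatingIntegral (n + 1) (Chebyshev.U ℝ k) = 0 := by
  rw [alternatingIntegral_apply]
  set α : ℝ := (k + 1) * Real.pi / (n + 1) with hα
  have h1 : ∀ j : ℕ, (Chebyshev.T ℝ (k + 1 : ℕ)).eval (Chebyshev.node (n + 1) j) =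
      Real.cos (α * j) := fun j => by
    rw [Chebyshev.node, Chebyshev.T_real_cos, hα]
    congr 1
    push_cast
    ring
  have hs : Real.sin (α * (n + 1 : ℕ)) = 0 := by
    rw [hα, ← Real.sin_nat_mul_pi (k + 1)]
    congr 1
    push_cast
    field_simp
  have hc : Real.cos (α / 2) ≠ 0 := by
    refine (Real.cos_pos_of_mem_Ioo ⟨?_, ?_⟩).ne'
    · have : 0 ≤ α := by positivity
      linarith [Real.pi_pos]
    · have : α < Real.pi := by
        rw [hα, div_lt_iff₀ (by positivity), mul_comm]
        have : (k : ℝ) < n := by exact_mod_cast hk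
        exact mul_lt_mul_of_pos_left (by linarith) Real.pi_pos
      linarith
  have := sum_alternating_cos_sub_cos hc hs
  simp only [integral_U, h1]
  calc _ = (∑ j ∈ Finset.range (n + 1),
        (-1) ^ j * (Real.cos (α * j) - Real.cos (α * (j + 1)))) / ((k : ℝ) + 1) := by
        rw [Finset.sum_div]
        refine Finset.sum_congr rfl fun j _ => ?_
        push_cast
        ring
    _ = 0 := by rw [this, zero_div]

/-- The top coefficient is removed by a multiple of `U_m`, which the functional kills; the node
count stays fixed while the degree bound `m` descends. -/
lemma alternatingIntegral_of_degree_lt {n m : ℕ} (hm : m ≤ n) {P : ℝ[X]} (hP : P.degree < m) :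
    alternatingIntegral (n + 1) P = 0 := by
  induction m generalizing P with
  | zero =>
    have : P = 0 := by simpa [Nat.WithBot.lt_zero_iff] using hP
    rw [this, map_zero]
  | succ m ih =>
    have hU : (Chebyshev.U ℝ m).coeff m = 2 ^ m := by
      have := Chebyshev.leadingCoeff_U_natCast ℝ m
      rwa [leadingCoeff, Chebyshev.natDegree_U_natCast] at this
    have hd : (P - (P.coeff m / 2 ^ m) • Chebyshev.U ℝ m).degree < m := by
      rw [degree_lt_iff_coeff_zero] at hP ⊢
      intro i hi
      rcases hi.eq_or_lt with rfl | hi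
      · rw [coeff_sub, coeff_smul, hU, smul_eq_mul]
        field_simp
        ring
      · rw [coeff_sub, coeff_smul, hP i hi,
          coeff_eq_zero_of_natDegree_lt (p := Chebyshev.U ℝ m) (by rwa [Chebyshev.natDegree_U_natCast])]
        simp
    have h := ih (by omega) hd
    rw [map_sub, map_smul, alternatingIntegral_U_of_lt (by omega)] at h
    simpa using h

/-- `ψ` differs from `2^{-n} U_n` by a polynomial of lower degree, which the functional kills. -/
lemma alternatingIntegral_of_mem_monicPolys {n : ℕ} {ψ : ℝ[X]} (hψ : ψ ∈ monicPolys n) :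
    alternatingIntegral (n + 1) ψ = 2 / 2 ^ n := by
  have hU : (Chebyshev.U ℝ n).coeff n = 2 ^ n := by
    have := Chebyshev.leadingCoeff_U_natCast ℝ n
    rwa [leadingCoeff, Chebyshev.natDegree_U_natCast] at this
  have hd : (ψ - ((2 : ℝ) ^ n)⁻¹ • Chebyshev.U ℝ n).degree < n := by
    rw [degree_lt_iff_coeff_zero]
    intro i hi
    rcases hi.eq_or_lt with rfl | hi
    · rw [coeff_sub, coeff_smul, hU, smul_eq_mul, inv_mul_cancel₀ (by positivity), sub_eq_zero]
      have := hψ.1.coeff_natDegree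
      rwa [hψ.2] at this
    · rw [coeff_sub, coeff_smul, coeff_eq_zero_of_natDegree_lt (hψ.2 ▸ hi),
        coeff_eq_zero_of_natDegree_lt (by rwa [Chebyshev.natDegree_U_natCast])]
      simp
  have h := alternatingIntegral_of_degree_lt le_rfl hd
  rw [map_sub, map_smul, alternatingIntegral_U_self, smul_eq_mul, sub_eq_zero] at h
  rw [h]
  ring

/-- With `x = cos θ`, `U_n(x) sin θ = sin ((n+1)θ)`. Between nodes `j+1` and `j` the angle `(n+1)θ`
lies in `[jπ, (j+1)π]`, so `(-1)^j U_n ≥ 0` there and the alternating integral is that of `|U_n|`.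
-/
lemma integral_abs_U_le (n : ℕ) : ∫ x in (-1)..1, |(Chebyshev.U ℝ n).eval x| ≤ 2 := by
  rw [← alternatingIntegral_U_self n, integral_abs_eq_sum_nodes n.succ_ne_zero,
    alternatingIntegral_apply]
  refine Finset.sum_le_sum fun j hj => ?_
  have hj := Finset.mem_range.1 hj
  have hc := (Chebyshev.U ℝ n).continuous
  rw [← intervalIntegral.integral_const_mul]
  refine intervalIntegral.integral_mono_on_of_le_Ioo (node_succ_le hj)
    (hc.abs.intervalIntegrable _ _) ((continuous_const.mul hc).intervalIntegrable _ _)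
    fun x hx => ?_
  have hN : (0 : ℝ) < (n + 1 : ℕ) := by positivity
  have hx1 : -1 < x := Chebyshev.node_mem_Icc.1.trans_lt hx.1
  have hx2 : x < 1 := hx.2.trans_le Chebyshev.node_mem_Icc.2
  set θ := Real.arccos x with hθ
  have hcos : Real.cos θ = x := Real.cos_arccos hx1.le hx2.le
  have hsin : 0 < Real.sin θ := by
    rw [hθ, Real.sin_arccos]
    exact Real.sqrt_pos.2 (by nlinarith)
  have hle : ∀ i : ℕ, i ≤ n + 1 → (i : ℝ) * Real.pi / (n + 1 : ℕ) ≤ Real.pi := fun i hi => by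
    rw [div_le_iff₀ hN, mul_comm]
    exact mul_le_mul_of_nonneg_left (by exact_mod_cast hi) Real.pi_pos.le
  have hlow : (j : ℝ) * Real.pi ≤ (n + 1 : ℕ) * θ := by
    have h := Real.arccos_le_arccos hx.2.le
    rw [Chebyshev.node, Real.arccos_cos (by positivity) (hle j hj.le), div_le_iff₀ hN] at h
    linarith
  have hup : (n + 1 : ℕ) * θ ≤ ((j : ℝ) + 1) * Real.pi := by
    have h := Real.arccos_le_arccos hx.1.le
    rw [Chebyshev.node, Real.arccos_cos (by positivity) (hle (j + 1) hj), le_div_iff₀ hN] at h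
    push_cast at h ⊢
    linarith
  have h1 := Chebyshev.U_real_cos θ n
  have h2 : 0 ≤ Real.sin ((n + 1 : ℕ) * θ - j * Real.pi) :=
    Real.sin_nonneg_of_nonneg_of_le_pi (by linarith) (by linarith)
  rw [Real.sin_sub_nat_mul_pi] at h2
  rw [hcos] at h1
  have h3 : 0 ≤ (-1) ^ j * (Chebyshev.U ℝ n).eval x := by
    refine nonneg_of_mul_nonneg_left (?_ : 0 ≤ _ * Real.sin θ) hsin
    rw [mul_assoc, h1]
    push_cast at h2 ⊢
    exact h2
  have h4 : |(Chebyshev.U ℝ n).eval x| = |(-1) ^ j * (Chebyshev.U ℝ n).eval x| := by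
    rw [abs_mul, abs_pow, abs_neg, abs_one, one_pow, one_mul]
  rw [h4, abs_of_nonneg h3]

lemma lpNormOn_one_eq {g : ℝ → ℝ} (hg : Continuous g) :
    lpNormOn 1 (-1) 1 g = ∫ x in (-1)..1, |g x| := by
  rw [lpNormOn_eq_rpow_integral one_ne_zero ENNReal.one_ne_top (by norm_num) hg]
  simp

lemma lpNormOn_one_ge_of_mem_monicPolys {n : ℕ} {ψ : ℝ[X]} (hψ : ψ ∈ monicPolys n) :
    2 / 2 ^ n ≤ lpNormOn 1 (-1) 1 (fun x => ψ.eval x) := by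
  rw [lpNormOn_one_eq ψ.continuous, ← alternatingIntegral_of_mem_monicPolys hψ]
  exact alternatingIntegral_le n.succ_ne_zero ψ

lemma exists_mem_monicPolys_lpNormOn_one_le (n : ℕ) :
    ∃ φ ∈ monicPolys n, lpNormOn 1 (-1) 1 (fun x => φ.eval x) ≤ 2 / 2 ^ n := by
  have hlc := Chebyshev.leadingCoeff_U_natCast ℝ n
  refine ⟨_, C_inv_mul_mem_monicPolys (n := n) (P := Chebyshev.U ℝ n) ?_
    (Chebyshev.natDegree_U_natCast ℝ n), ?_⟩
  · rw [← leadingCoeff_ne_zero, hlc]; positivity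
  · rw [lpNormOn_one_eq (Polynomial.continuous _), hlc]
    simp only [eval_mul, eval_C, abs_mul]
    rw [intervalIntegral.integral_const_mul, abs_of_pos (by positivity), div_eq_inv_mul]
    exact mul_le_mul_of_nonneg_left (integral_abs_U_le n) (by positivity)

/-! #### The exponent `2` -/

lemma integral_derivative_mul {P : ℝ[X]} (Q : ℝ[X]) {a b : ℝ} (ha : P.eval a = 0)
    (hb : P.eval b = 0) :
    ∫ x in a..b, (derivative P).eval x * Q.eval x =
      -∫ x in a..b, P.eval x * (derivative Q).eval x := by
  have h := integral_derivative (P * Q) a b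
  simp only [derivative_mul, eval_add, eval_mul, ha, hb, zero_mul, sub_zero] at h
  rw [intervalIntegral.integral_add
    (Continuous.intervalIntegrable (by fun_prop) _ _)
    (Continuous.intervalIntegrable (by fun_prop) _ _)] at h
  linarith

lemma integral_iterate_derivative_mul {P : ℝ[X]} {a b : ℝ} {n : ℕ}
    (ha : ∀ k < n, (derivative^[k] P).eval a = 0) (hb : ∀ k < n, (derivative^[k] P).eval b = 0)
    (Q : ℝ[X]) :
    ∫ x in a..b, (derivative^[n] P).eval x * Q.eval x =
      (-1) ^ n * ∫ x in a..b, P.eval x * (derivative^[n] Q).eval x := by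
  induction n generalizing Q with
  | zero => simp
  | succ n ih =>
    rw [Function.iterate_succ_apply',
      integral_derivative_mul Q (ha n n.lt_succ_self) (hb n n.lt_succ_self),
      ih (fun k hk => ha k (by omega)) (fun k hk => hb k (by omega)),
      ← Function.iterate_succ_apply, pow_succ]
    ring

lemma integral_X_sq_sub_one_pow (n : ℕ) :
    ∫ x in (-1)..1, ((X ^ 2 - 1 : ℝ[X]) ^ n).eval x =
      (-1) ^ n * (2 ^ (2 * n + 1) * (n.factorial : ℝ) ^ 2 / (2 * n + 1).factorial) := by
  induction n with
  | zero => norm_num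
  | succ n ih =>
    -- This polynomial vanishes at `±1`, and its derivative is a combination of the integrands for
    -- `n + 1` and `n`, which gives the recursion.
    have h := integral_derivative (X * (X ^ 2 - 1 : ℝ[X]) ^ (n + 1)) (-1) 1
    have hd : derivative (X * (X ^ 2 - 1 : ℝ[X]) ^ (n + 1)) =
        C (2 * (n : ℝ) + 3) * (X ^ 2 - 1) ^ (n + 1) + C (2 * (n : ℝ) + 2) * (X ^ 2 - 1) ^ n := by
      simp only [derivative_mul, derivative_X, derivative_pow, derivative_sub, derivative_one,
        map_add, map_mul, map_natCast, map_ofNat, Nat.cast_add, Nat.cast_one,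
        Nat.add_sub_cancel, map_one]
      ring
    rw [hd] at h
    simp only [eval_add, eval_mul (p := C _), eval_C] at h
    rw [intervalIntegral.integral_add
      (Continuous.intervalIntegrable (by fun_prop) _ _)
      (Continuous.intervalIntegrable (by fun_prop) _ _),
      intervalIntegral.integral_const_mul, intervalIntegral.integral_const_mul, ih] at h
    have hr : eval 1 (X * (X ^ 2 - 1 : ℝ[X]) ^ (n + 1)) -
        eval (-1) (X * (X ^ 2 - 1 : ℝ[X]) ^ (n + 1)) = 0 := by simp
    rw [hr] at h
    have hf : ((2 * (n + 1) + 1).factorial : ℝ) =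
        (2 * n + 3) * (2 * n + 2) * (2 * n + 1).factorial := by
      rw [show 2 * (n + 1) + 1 = (2 * n + 1) + 1 + 1 by ring, Nat.factorial_succ,
        Nat.factorial_succ]
      push_cast
      ring
    have h3 : (2 * (n : ℝ) + 3) ≠ 0 := by positivity
    have : ∫ x in (-1)..1, ((X ^ 2 - 1 : ℝ[X]) ^ (n + 1)).eval x =
        -((2 * (n : ℝ) + 2) * ((-1) ^ n *
          (2 ^ (2 * n + 1) * (n.factorial : ℝ) ^ 2 / (2 * n + 1).factorial))) /
            (2 * (n : ℝ) + 3) := by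
      rw [eq_div_iff h3]
      linarith
    rw [this, hf, Nat.factorial_succ n]
    push_cast
    have h4 : ((2 * n + 1).factorial : ℝ) ≠ 0 := by positivity
    field_simp
    ring

/-- The least value of `∫ ψ²` over `[-1,1]` among the monic polynomials `ψ` of degree `n`. -/
def legendreNormSq (n : ℕ) : ℝ :=
  2 * (2 ^ n * (n.factorial : ℝ) ^ 2 / (2 * n).factorial) ^ 2 / (2 * n + 1)

/-- The monic Legendre polynomial of degree `n`, by Rodrigues' formula. -/
def monicLegendre (n : ℕ) : ℝ[X] :=
  C ((n.factorial : ℝ) / (2 * n).factorial) * derivative^[n] ((X ^ 2 - 1) ^ n)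

lemma natDegree_X_sq_sub_one : (X ^ 2 - 1 : ℝ[X]).natDegree = 2 :=
  natDegree_X_pow_sub_C (n := 2) (r := (1 : ℝ))

lemma monic_X_sq_sub_one : (X ^ 2 - 1 : ℝ[X]).Monic := monic_X_pow_sub_C (1 : ℝ) two_ne_zero

lemma monicLegendre_mem_monicPolys (n : ℕ) : monicLegendre n ∈ monicPolys n := by
  have hm : ((X ^ 2 - 1 : ℝ[X]) ^ n).Monic := monic_X_sq_sub_one.pow n
  have hd : ((X ^ 2 - 1 : ℝ[X]) ^ n).natDegree = 2 * n := by
    rw [natDegree_pow, natDegree_X_sq_sub_one, mul_comm]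
  have hdeg : (monicLegendre n).natDegree ≤ n := by
    refine (natDegree_C_mul_le _ _).trans ((natDegree_iterate_derivative _ _).trans ?_)
    omega
  have hc : (monicLegendre n).coeff n = 1 := by
    rw [monicLegendre, coeff_C_mul, coeff_iterate_derivative, ← two_mul]
    have : ((X ^ 2 - 1 : ℝ[X]) ^ n).coeff (2 * n) = 1 := by
      rw [← hd]; exact hm.coeff_natDegree
    rw [this, nsmul_eq_mul, mul_one]
    have h := Nat.factorial_mul_descFactorial (show n ≤ 2 * n by omega)
    rw [show 2 * n - n = n by omega] at h
    rw [← h]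
    push_cast
    have : ((2 * n).descFactorial n : ℝ) ≠ 0 := by
      exact_mod_cast (Nat.descFactorial_pos.2 (by omega)).ne'
    field_simp
  exact ⟨monic_of_natDegree_le_of_coeff_eq_one n hdeg hc,
    le_antisymm hdeg (le_natDegree_of_ne_zero (by rw [hc]; exact one_ne_zero))⟩

lemma eval_iterate_derivative_X_sq_sub_one_pow {n k : ℕ} (hk : k < n) {t : ℝ} (ht : t ^ 2 = 1) :
    (derivative^[k] ((X ^ 2 - 1 : ℝ[X]) ^ n)).eval t = 0 := by
  have h := isRoot_iterate_derivative_of_lt_rootMultiplicity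
    (p := (X ^ 2 - 1 : ℝ[X]) ^ n) (t := t) (n := k) ?_
  · exact h
  · refine hk.trans_le ?_
    rw [le_rootMultiplicity_iff (monic_X_sq_sub_one.pow n).ne_zero]
    refine pow_dvd_pow_of_dvd (dvd_iff_isRoot.2 ?_) n
    simp [IsRoot, ht]

lemma iterate_derivative_of_mem_monicPolys {n : ℕ} {ψ : ℝ[X]} (hψ : ψ ∈ monicPolys n) :
    derivative^[n] ψ = C (n.factorial : ℝ) := by
  have hd : (derivative^[n] ψ).natDegree = 0 := by
    have := natDegree_iterate_derivative ψ n
    rw [hψ.2] at this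
    omega
  rw [eq_C_of_natDegree_eq_zero hd, coeff_iterate_derivative, zero_add, Nat.descFactorial_self]
  have := hψ.1.coeff_natDegree
  rw [hψ.2] at this
  rw [this]
  simp

/-- By Rodrigues' formula, `n` integrations by parts move all derivatives onto `ψ`, leaving the
constant `n!`; the boundary terms vanish since `±1` are zeros of `(X² - 1)^n` of order `n`. -/
lemma integral_monicLegendre_mul {n : ℕ} {ψ : ℝ[X]} (hψ : ψ ∈ monicPolys n) :
    ∫ x in (-1)..1, (monicLegendre n).eval x * ψ.eval x = legendreNormSq n := by
  have h := integral_iterate_derivative_mul (P := (X ^ 2 - 1 : ℝ[X]) ^ n) (a := -1) (b := 1)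
    (n := n) (fun k hk => eval_iterate_derivative_X_sq_sub_one_pow hk (by norm_num))
    (fun k hk => eval_iterate_derivative_X_sq_sub_one_pow hk (by norm_num)) ψ
  rw [iterate_derivative_of_mem_monicPolys hψ] at h
  simp only [eval_C] at h
  rw [intervalIntegral.integral_mul_const, integral_X_sq_sub_one_pow] at h
  simp only [monicLegendre, eval_mul (p := C _), eval_C, mul_assoc]
  rw [intervalIntegral.integral_const_mul, h, legendreNormSq, Nat.factorial_succ]
  have h1 : (-1 : ℝ) ^ n * (-1) ^ n = 1 := by rw [← mul_pow]; norm_num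
  push_cast
  rw [← mul_assoc ((-1 : ℝ) ^ n), ← mul_assoc ((-1 : ℝ) ^ n), h1, one_mul]
  have h4 : ((2 * n).factorial : ℝ) ≠ 0 := by positivity
  have h5 : (2 * (n : ℝ) + 1) ≠ 0 := by positivity
  field_simp
  ring

lemma integral_sq_monicLegendre (n : ℕ) :
    ∫ x in (-1)..1, (monicLegendre n).eval x ^ 2 = legendreNormSq n := by
  simp only [sq]
  exact integral_monicLegendre_mul (monicLegendre_mem_monicPolys n)

/-- Expand `∫ (ψ - L)² ≥ 0` with `L` the monic Legendre polynomial: `∫ L ψ` and `∫ L²` coincide. -/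
lemma legendreNormSq_le_integral_sq {n : ℕ} {ψ : ℝ[X]} (hψ : ψ ∈ monicPolys n) :
    legendreNormSq n ≤ ∫ x in (-1)..1, ψ.eval x ^ 2 := by
  have h0 : 0 ≤ ∫ x in (-1)..1, (ψ.eval x - (monicLegendre n).eval x) ^ 2 :=
    intervalIntegral.integral_nonneg (by norm_num) fun _ _ => sq_nonneg _
  have hc := ψ.continuous
  have hL := (monicLegendre n).continuous
  have e : ∀ x, (ψ.eval x - (monicLegendre n).eval x) ^ 2 = ψ.eval x ^ 2 -
      2 * ((monicLegendre n).eval x * ψ.eval x) + (monicLegendre n).eval x ^ 2 := fun x => by ring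
  simp only [e] at h0
  rw [intervalIntegral.integral_add (Continuous.intervalIntegrable (by fun_prop) _ _)
    (Continuous.intervalIntegrable (by fun_prop) _ _), intervalIntegral.integral_sub
    (Continuous.intervalIntegrable (by fun_prop) _ _)
    (Continuous.intervalIntegrable (by fun_prop) _ _), intervalIntegral.integral_const_mul,
    integral_monicLegendre_mul hψ, integral_sq_monicLegendre] at h0
  linarith

lemma lpNormOn_two_eq {g : ℝ → ℝ} (hg : Continuous g) :
    lpNormOn 2 (-1) 1 g = √(∫ x in (-1)..1, g x ^ 2) := by
  rw [lpNormOn_eq_rpow_integral two_ne_zero ENNReal.ofNat_ne_top (by norm_num) hg,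
    Real.sqrt_eq_rpow]
  simp

/-! ### Existence of a monic polynomial of least norm -/

/-- The class of a polynomial in `L^q([-1,1])`. -/
def polynomialToLp (q : ℝ≥0∞) : ℝ[X] →ₗ[ℝ] Lp ℝ q (volume.restrict (Icc (-1 : ℝ) 1)) where
  toFun P := (memLp_Icc_of_continuous P.continuous q (-1) 1).toLp (fun x => P.eval x)
  map_add' P Q := by
    rw [← MemLp.toLp_add]
    congr 1
    ext x
    simp
  map_smul' c P := by
    rw [RingHom.id_apply, ← MemLp.toLp_const_smul]
    congr 1
    ext x
    simp

lemma norm_polynomialToLp (q : ℝ≥0∞) (P : ℝ[X]) :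
    ‖polynomialToLp q P‖ = lpNormOn q (-1) 1 (fun x => P.eval x) :=
  Lp.norm_toLp _ (memLp_Icc_of_continuous P.continuous q (-1) 1)

lemma X_pow_add_mem_monicPolys {n : ℕ} {P : ℝ[X]} (hP : P ∈ degreeLT ℝ n) :
    X ^ n + P ∈ monicPolys n := by
  have hP := mem_degreeLT.1 hP
  refine ⟨monic_X_pow_add hP, ?_⟩
  rw [natDegree_add_eq_left_of_degree_lt (by simpa using hP), natDegree_X_pow]

lemma sub_X_pow_mem_degreeLT {n : ℕ} {ψ : ℝ[X]} (hψ : ψ ∈ monicPolys n) :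
    ψ - X ^ n ∈ degreeLT ℝ n := by
  have hd : ψ.degree = n := by rw [degree_eq_natDegree hψ.1.ne_zero, hψ.2]
  rw [mem_degreeLT, ← hd]
  exact degree_sub_lt_left (by simp [hd]) hψ.1.ne_zero (by simp [hψ.1.leadingCoeff])

/-- Monic polynomials are `X^n` plus a polynomial of degree below `n`. The latter have a
finite-dimensional, hence proper, image in `L^q`, on which the norm of the translate is continuous
and coercive. -/
lemma exists_mem_monicPolys_forall_lpNormOn_le (n : ℕ) {q : ℝ≥0∞} (hq : 1 ≤ q) :
    ∃ φ ∈ monicPolys n, ∀ ψ ∈ monicPolys n,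
      lpNormOn q (-1) 1 (fun x => φ.eval x) ≤ lpNormOn q (-1) 1 (fun x => ψ.eval x) := by
  have : Fact (1 ≤ q) := ⟨hq⟩
  let S := (degreeLT ℝ n).map (polynomialToLp q)
  have : Module.Finite ℝ (degreeLT ℝ n) := .equiv (degreeLTEquiv ℝ n).symm
  have : FiniteDimensional ℝ S := inferInstance
  have : ProperSpace S := FiniteDimensional.proper ℝ S
  obtain ⟨s, hs⟩ := Continuous.exists_forall_le
    (f := fun s : S => ‖polynomialToLp q (X ^ n) + (s : Lp ℝ q _)‖) (by fun_prop) (by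
      refine Filter.tendsto_atTop_mono (fun s => ?_) (Filter.tendsto_atTop_add_const_right _
        (-‖polynomialToLp q (X ^ n)‖) (tendsto_norm_cocompact_atTop (E := S)))
      have := norm_sub_norm_le (s : Lp ℝ q _) (-polynomialToLp q (X ^ n))
      rw [norm_neg, sub_neg_eq_add] at this
      rw [← sub_eq_add_neg, add_comm (polynomialToLp q (X ^ n))]
      exact this)
  obtain ⟨P, hP, hPs⟩ := s.2
  refine ⟨X ^ n + P, X_pow_add_mem_monicPolys hP, fun ψ hψ => ?_⟩
  have h := hs ⟨_, Submodule.mem_map_of_mem (sub_X_pow_mem_degreeLT hψ)⟩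
  simp only [← hPs, ← map_add, add_sub_cancel] at h
  rwa [norm_polynomialToLp, norm_polynomialToLp] at h

/-! ### Strict monotonicity of the normalised norms -/

lemma not_eqOn_abs_eval_const {n : ℕ} (hn : 1 ≤ n) {φ : ℝ[X]} (hφ : φ ∈ monicPolys n) {a b : ℝ}
    (hab : a < b) (c : ℝ) : ¬ ∀ x ∈ Icc a b, |φ.eval x| = c := by
  intro h
  -- Squaring removes the absolute value; the resulting polynomial identity forces `2n = 0`.
  have h0 : φ ^ 2 - C (c ^ 2) = 0 := by
    refine eq_zero_of_infinite_isRoot _ ((Icc_infinite hab).mono fun x hx => ?_)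
    simp [← h x hx]
  have h1 := congrArg natDegree (sub_eq_zero.1 h0)
  rw [natDegree_pow, natDegree_C, hφ.2] at h1
  omega

/-- Strict Jensen for `t ↦ t^{r/q}`, applied to the average of `|φ|^q` over `[-1,1]`; the equality
case would make `|φ|` constant. -/
lemma normalized_lpNormOn_lt_of_ne_top {n : ℕ} (hn : 1 ≤ n) {φ : ℝ[X]} (hφ : φ ∈ monicPolys n)
    {q r : ℝ≥0∞} (hq : 1 ≤ q) (hqr : q < r) (hr : r ≠ ∞) :
    (2 : ℝ) ^ (-q.toReal⁻¹) * lpNormOn q (-1) 1 (fun x => φ.eval x) <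
      (2 : ℝ) ^ (-r.toReal⁻¹) * lpNormOn r (-1) 1 (fun x => φ.eval x) := by
  have h11 : (-1 : ℝ) < 1 := by norm_num
  have hqt : q ≠ ∞ := (hqr.trans_le le_top).ne
  have hq0 : q ≠ 0 := (zero_lt_one.trans_le hq).ne'
  have hr0 : r ≠ 0 := (zero_lt_one.trans_le (hq.trans hqr.le)).ne'
  have hQ : 0 < q.toReal := ENNReal.toReal_pos hq0 hqt
  have hR : 0 < r.toReal := ENNReal.toReal_pos hr0 hr
  have hQR : q.toReal < r.toReal := (ENNReal.toReal_lt_toReal hqt hr).2 hqr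
  have hc := φ.continuous
  have hcont : ∀ s : ℝ, 0 < s → Continuous fun x => |φ.eval x| ^ s := fun s hs =>
    hc.abs.rpow_const fun _ => .inr hs.le
  have hcomp : ∀ x, (|φ.eval x| ^ q.toReal) ^ (r.toReal / q.toReal) = |φ.eval x| ^ r.toReal :=
    fun x => by rw [← Real.rpow_mul (abs_nonneg _), mul_div_cancel₀ _ hQ.ne']
  have hint : ∀ s : ℝ, 0 < s → Integrable (fun x => |φ.eval x| ^ s)
      (volume.restrict (Icc (-1 : ℝ) 1)) := fun s hs =>
    (hcont s hs).continuousOn.integrableOn_compact isCompact_Icc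
  have havg : ∀ f : ℝ → ℝ, ⨍ x, f x ∂(volume.restrict (Icc (-1 : ℝ) 1)) =
      2⁻¹ * ∫ x in (-1)..1, f x := fun f => by
    rw [setAverage_eq, intervalIntegral.integral_of_le h11.le, integral_Icc_eq_integral_Ioc]
    norm_num [Measure.real]
  have hJ := (strictConvexOn_rpow ((one_lt_div hQ).2 hQR)).ae_eq_const_or_map_average_lt
    (μ := volume.restrict (Icc (-1 : ℝ) 1)) (f := fun x => |φ.eval x| ^ q.toReal)
    (Real.continuous_rpow_const (by positivity)).continuousOn isClosed_Ici
    (.of_forall fun x => Real.rpow_nonneg (abs_nonneg _) _) (hint _ hQ)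
    (by simpa only [Function.comp_def, hcomp] using hint _ hR)
  simp only [havg, hcomp] at hJ
  rcases hJ with hJ | hJ
  · exfalso
    have heq := Measure.eqOn_Icc_of_ae_eq volume h11.ne hJ (hcont _ hQ).continuousOn
      continuousOn_const
    refine not_eqOn_abs_eval_const hn hφ h11
      ((2⁻¹ * ∫ x in (-1)..1, |φ.eval x| ^ q.toReal) ^ q.toReal⁻¹) fun x hx => ?_
    rw [← Real.rpow_rpow_inv (abs_nonneg (φ.eval x)) hQ.ne']
    exact congrArg (· ^ q.toReal⁻¹) (heq hx)
  · rw [lpNormOn_eq_rpow_integral hq0 hqt h11.le hc, lpNormOn_eq_rpow_integral hr0 hr h11.le hc]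
    have hnn : ∀ s : ℝ, 0 ≤ ∫ x in (-1)..1, |φ.eval x| ^ s := fun s =>
      intervalIntegral.integral_nonneg h11.le fun _ _ => by positivity
    have hpull : ∀ s : ℝ, (2 : ℝ) ^ (-s⁻¹) * (∫ x in (-1)..1, |φ.eval x| ^ s) ^ s⁻¹ =
        (2⁻¹ * ∫ x in (-1)..1, |φ.eval x| ^ s) ^ s⁻¹ := fun s => by
      rw [Real.mul_rpow (by norm_num) (hnn s), Real.rpow_neg (by norm_num),
        Real.inv_rpow (by norm_num)]
    rw [hpull, hpull]
    have h0 : 0 ≤ 2⁻¹ * ∫ x in (-1)..1, |φ.eval x| ^ q.toReal :=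
      mul_nonneg (by norm_num) (hnn _)
    have := Real.rpow_lt_rpow (Real.rpow_nonneg h0 _) hJ (inv_pos.2 hR)
    rwa [← Real.rpow_mul h0, div_mul_eq_mul_div, mul_inv_cancel₀ hR.ne', one_div] at this

lemma normalized_lpNormOn_le_top {q : ℝ≥0∞} {g : ℝ → ℝ} (hg : Continuous g) :
    (2 : ℝ) ^ (-q.toReal⁻¹) * lpNormOn q (-1) 1 g ≤ lpNormOn ∞ (-1) 1 g := by
  have h := eLpNorm_le_eLpNorm_mul_rpow_measure_univ (μ := volume.restrict (Icc (-1 : ℝ) 1))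
    (le_top : q ≤ ∞) hg.aestronglyMeasurable
  have hμ : (volume.restrict (Icc (-1 : ℝ) 1)) univ = ENNReal.ofReal 2 := by
    rw [Measure.restrict_apply_univ, Real.volume_Icc]
    norm_num
  rw [hμ, ENNReal.ofReal_rpow_of_pos two_pos] at h
  have h' := ENNReal.toReal_mono (ENNReal.mul_ne_top
    (memLp_Icc_of_continuous hg ∞ (-1) 1).eLpNorm_ne_top ENNReal.ofReal_ne_top) h
  rw [ENNReal.toReal_mul, ENNReal.toReal_ofReal (by positivity)] at h'
  rw [Real.rpow_neg two_pos.le, inv_mul_le_iff₀ (by positivity), mul_comm]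
  simpa [lpNormOn] using h'

lemma normalized_lpNormOn_lt {n : ℕ} (hn : 1 ≤ n) {φ : ℝ[X]} (hφ : φ ∈ monicPolys n)
    {q r : ℝ≥0∞} (hq : 1 ≤ q) (hqr : q < r) :
    (2 : ℝ) ^ (-q.toReal⁻¹) * lpNormOn q (-1) 1 (fun x => φ.eval x) <
      (2 : ℝ) ^ (-r.toReal⁻¹) * lpNormOn r (-1) 1 (fun x => φ.eval x) := by
  rcases eq_or_ne r ∞ with rfl | hr
  -- For `r = ∞`, strictness is gained between `q` and the finite exponent `q + 1`; a weak
  -- inequality then leads to `∞`.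
  · have hq' : q + 1 ≠ ∞ := ENNReal.add_ne_top.2 ⟨hqr.ne, ENNReal.one_ne_top⟩
    have h := normalized_lpNormOn_lt_of_ne_top hn hφ hq
      (ENNReal.lt_add_right hqr.ne one_ne_zero) hq'
    simpa using h.trans_le (normalized_lpNormOn_le_top φ.continuous)
  · exact normalized_lpNormOn_lt_of_ne_top hn hφ hq hqr hr

lemma one_le_conjExponent (p : ℝ≥0∞) : 1 ≤ ENNReal.conjExponent p := by
  simp [ENNReal.conjExponent]

lemma conjExponent_lt_conjExponent {p r : ℝ≥0∞} (hp : 1 ≤ p) (hpr : p < r) :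
    ENNReal.conjExponent r < ENNReal.conjExponent p := by
  unfold ENNReal.conjExponent
  exact ENNReal.add_lt_add_left ENNReal.one_ne_top
    (ENNReal.inv_lt_inv.2 (lt_tsub_iff_right.2 (by rwa [tsub_add_cancel_of_le hp])))

lemma strictAntiOn_errorConst {n : ℕ} (hn : 1 ≤ n) {φ : ℝ[X]} (hφ : φ ∈ monicPolys n) :
    StrictAntiOn (fun p : ℝ≥0∞ => errorConst n p φ) (Ici 1) := by
  intro p hp r hr hpr
  have hp : 1 ≤ p := hp
  simp only [errorConst_eq hn hp hφ.1.ne_zero, errorConst_eq hn hr hφ.1.ne_zero]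
  have h := normalized_lpNormOn_lt hn hφ (one_le_conjExponent r)
    (conjExponent_lt_conjExponent hp hpr)
  rw [← invConj_eq_inv_toReal, ← invConj_eq_inv_toReal] at h
  simp only [sub_eq_add_neg, Real.rpow_add two_pos, mul_assoc]
  gcongr

/-! ### The optimal constant -/

lemma isLeast_errorConst {n : ℕ} (hn : 1 ≤ n) {p : ℝ≥0∞} (hp : 1 ≤ p) {φ : ℝ[X]}
    (hφ : φ ∈ monicPolys n)
    (hmin : ∀ ψ ∈ monicPolys n, lpNormOn (ENNReal.conjExponent p) (-1) 1 (fun x => φ.eval x) ≤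
      lpNormOn (ENNReal.conjExponent p) (-1) 1 (fun x => ψ.eval x)) :
    IsLeast (errorConst n p '' monicPolys n) (errorConst n p φ) := by
  refine ⟨mem_image_of_mem _ hφ, ?_⟩
  rintro _ ⟨ψ, hψ, rfl⟩
  rw [errorConst_eq hn hp hφ.1.ne_zero, errorConst_eq hn hp hψ.1.ne_zero]
  have := hmin ψ hψ
  gcongr

lemma exists_isLeast_errorConst {n : ℕ} (hn : 1 ≤ n) {p : ℝ≥0∞} (hp : 1 ≤ p) :
    ∃ φ ∈ monicPolys n, IsLeast (errorConst n p '' monicPolys n) (errorConst n p φ) := by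
  obtain ⟨φ, hφ, hmin⟩ := exists_mem_monicPolys_forall_lpNormOn_le n (one_le_conjExponent p)
  exact ⟨φ, hφ, isLeast_errorConst hn hp hφ hmin⟩

lemma optimalConst_eq_of_lpNormOn {n : ℕ} (hn : 1 ≤ n) {p : ℝ≥0∞} (hp : 1 ≤ p) {m : ℝ}
    (hle : ∀ ψ ∈ monicPolys n, m ≤ lpNormOn (ENNReal.conjExponent p) (-1) 1 (fun x => ψ.eval x))
    (hex : ∃ φ ∈ monicPolys n,
      lpNormOn (ENNReal.conjExponent p) (-1) 1 (fun x => φ.eval x) ≤ m) :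
    optimalConst n p = (2 : ℝ) ^ (-(n : ℝ) - invConj p) * m / (n.factorial : ℝ) := by
  obtain ⟨φ, hφ, hφm⟩ := hex
  have h := isLeast_errorConst hn hp hφ fun ψ hψ => hφm.trans (hle ψ hψ)
  rw [optimalConst, h.csInf_eq, errorConst_eq hn hp hφ.1.ne_zero, le_antisymm hφm (hle φ hφ)]

/-- The minimizer for the smaller exponent `p` is a competitor for `r`, and its own constant drops
strictly from `p` to `r`. -/
lemma strictAntiOn_optimalConst {n : ℕ} (hn : 1 ≤ n) :
    StrictAntiOn (fun p : ℝ≥0∞ => optimalConst n p) (Ici 1) := by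
  intro p hp r hr hpr
  obtain ⟨φ, hφ, h⟩ := exists_isLeast_errorConst hn hp
  obtain ⟨χ, -, h'⟩ := exists_isLeast_errorConst hn hr
  simp only [optimalConst, h.csInf_eq, h'.csInf_eq]
  exact (h'.2 (mem_image_of_mem _ hφ)).trans_lt (strictAntiOn_errorConst hn hφ hp hr hpr)

/-! ### Explicit values for `p = 1, ∞, 2` -/

lemma invConj_one : invConj 1 = 0 := by simp [invConj, conjExponent_one]

lemma invConj_top : invConj ∞ = 1 := by simp [invConj, conjExponent_top]

lemma conjExponent_two : ENNReal.conjExponent 2 = 2 :=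
  ENNReal.HolderConjugate.conjExponent_eq

lemma invConj_two : invConj 2 = 1 / 2 := by simp [invConj, conjExponent_two]

lemma optimalConst_one {n : ℕ} (hn : 1 ≤ n) :
    optimalConst n 1 = (2 : ℝ) ^ (1 - 2 * (n : ℤ)) / (n.factorial : ℝ) := by
  rw [optimalConst_eq_of_lpNormOn hn le_rfl (m := ((2 : ℝ) ^ (n - 1))⁻¹), invConj_one, sub_zero,
    Real.rpow_neg two_pos.le, Real.rpow_natCast, ← mul_inv, ← pow_add]
  -- The truncated `n - 1` agrees with integer subtraction because `n ≥ 1`.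
  · rw [show 1 - 2 * (n : ℤ) = -((n + (n - 1) : ℕ) : ℤ) by omega, zpow_neg, zpow_natCast]
  · rw [conjExponent_one]
    exact fun ψ hψ => lpNormOn_top_ge_of_mem_monicPolys hψ
  · rw [conjExponent_one]
    exact exists_mem_monicPolys_lpNormOn_top_le n

lemma optimalConst_top {n : ℕ} (hn : 1 ≤ n) :
    optimalConst n ∞ = (2 : ℝ) ^ (-2 * (n : ℤ)) / (n.factorial : ℝ) := by
  rw [optimalConst_eq_of_lpNormOn hn le_top (m := 2 / 2 ^ n), invConj_top,
    show -(n : ℝ) - 1 = -((n + 1 : ℕ) : ℝ) by push_cast; ring,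
    Real.rpow_neg two_pos.le, Real.rpow_natCast,
    show -2 * (n : ℤ) = -((n + n : ℕ) : ℤ) by push_cast; ring, zpow_neg, zpow_natCast]
  · congr 1
    rw [pow_add, pow_succ]
    field_simp
    ring
  · rw [conjExponent_top]
    exact fun ψ hψ => lpNormOn_one_ge_of_mem_monicPolys hψ
  · rw [conjExponent_top]
    exact exists_mem_monicPolys_lpNormOn_one_le n

lemma optimalConst_two {n : ℕ} (hn : 1 ≤ n) :
    optimalConst n 2 =
      (n.factorial : ℝ) * (2 * (n : ℝ) + 1) ^ (-(1 / 2) : ℝ) / ((2 * n).factorial : ℝ) := by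
  rw [optimalConst_eq_of_lpNormOn hn one_le_two (m := √(legendreNormSq n)), invConj_two]
  · have h1 : √(legendreNormSq n) =
        √2 * (2 ^ n * (n.factorial : ℝ) ^ 2 / (2 * n).factorial) / √(2 * n + 1) := by
      rw [legendreNormSq, Real.sqrt_div (by positivity), Real.sqrt_mul (by norm_num),
        Real.sqrt_sq (by positivity)]
    have h2 : (2 : ℝ) ^ (-(n : ℝ) - 1 / 2) = (2 ^ n)⁻¹ * (√2)⁻¹ := by
      rw [sub_eq_add_neg, Real.rpow_add two_pos, Real.rpow_neg two_pos.le,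
        Real.rpow_neg two_pos.le, Real.rpow_natCast, Real.sqrt_eq_rpow]
    rw [h1, h2, Real.rpow_neg (by positivity), ← Real.sqrt_eq_rpow]
    have h3 : √(2 : ℝ) ≠ 0 := by positivity
    have h4 : √(2 * (n : ℝ) + 1) ≠ 0 := by positivity
    field_simp
  · rw [conjExponent_two]
    intro ψ hψ
    rw [lpNormOn_two_eq ψ.continuous]
    exact Real.sqrt_le_sqrt (legendreNormSq_le_integral_sq hψ)
  · rw [conjExponent_two]
    refine ⟨_, monicLegendre_mem_monicPolys n, ?_⟩
    rw [lpNormOn_two_eq (Polynomial.continuous _), integral_sq_monicLegendre]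

end Quadrature

end

theorem mainTheorem7 (n : ℕ) (hn : 1 ≤ n) :
    -- the infima that define the constants are minima, given by the norm of the minimizing `φ`
    (∀ p : ℝ≥0∞, 1 ≤ p →
      (∀ φ ∈ Quadrature.monicPolys n,
        IsLeast {C : ℝ | Quadrature.IsErrorConstant n p φ C} (Quadrature.errorConst n p φ)) ∧
      ∃ φ ∈ Quadrature.monicPolys n,
        (∀ ψ ∈ Quadrature.monicPolys n,
          Quadrature.errorConst n p φ ≤ Quadrature.errorConst n p ψ) ∧
        Quadrature.optimalConst n p = Quadrature.errorConst n p φ ∧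
        Quadrature.optimalConst n p =
          (2 : ℝ) ^ (-(n : ℝ) - Quadrature.invConj p) *
            Quadrature.lpNormOn (ENNReal.conjExponent p) (-1) 1 (fun x => φ.eval x) / (n.factorial : ℝ)) ∧
    -- the explicit values
    Quadrature.optimalConst n 1 = (2 : ℝ) ^ (1 - 2 * (n : ℤ)) / (n.factorial : ℝ) ∧
    Quadrature.optimalConst n 2 =
      (n.factorial : ℝ) * (2 * (n : ℝ) + 1) ^ (-(1 / 2) : ℝ) / ((2 * n).factorial : ℝ) ∧
    Quadrature.optimalConst n ∞ = (2 : ℝ) ^ (-2 * (n : ℤ)) / (n.factorial : ℝ) ∧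
    -- monotonicity in `p ∈ [1, ∞]`, for the optimal constant and for each fixed polynomial
    StrictAntiOn (fun p : ℝ≥0∞ => Quadrature.optimalConst n p) (Ici 1) ∧
    (∀ φ ∈ Quadrature.monicPolys n,
      StrictAntiOn (fun p : ℝ≥0∞ => Quadrature.errorConst n p φ) (Ici 1)) ∧
    (∀ p : ℝ≥0∞, 1 ≤ p → Quadrature.optimalConst n p ≤ Quadrature.optimalConst n 1) ∧
    (∀ p : ℝ≥0∞, 1 ≤ p → ∀ φ ∈ Quadrature.monicPolys n,
      Quadrature.errorConst n p φ ≤ Quadrature.errorConst n 1 φ) := by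
  refine ⟨fun p hp => ⟨fun φ hφ => ?_, ?_⟩, Quadrature.optimalConst_one hn,
    Quadrature.optimalConst_two hn, Quadrature.optimalConst_top hn,
    Quadrature.strictAntiOn_optimalConst hn, fun φ hφ => Quadrature.strictAntiOn_errorConst hn hφ,
    fun p hp => (Quadrature.strictAntiOn_optimalConst hn).antitoneOn self_mem_Ici hp hp,
    fun p hp φ hφ =>
      (Quadrature.strictAntiOn_errorConst hn hφ).antitoneOn self_mem_Ici hp hp⟩
  · have h := Quadrature.isLeast_norm hn hp hφ.1.ne_zero
    rwa [← Quadrature.errorConst_eq hn hp hφ.1.ne_zero] at h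
  · obtain ⟨φ, hφ, h⟩ := Quadrature.exists_isLeast_errorConst hn hp
    have hopt : Quadrature.optimalConst n p = Quadrature.errorConst n p φ := h.csInf_eq
    exact ⟨φ, hφ, fun ψ hψ => h.2 (mem_image_of_mem _ hψ), hopt,
      hopt.trans (Quadrature.errorConst_eq hn hp hφ.1.ne_zero)⟩
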